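/- Let $\mathbf{F}_q$ be a finite field with $q$ elements, and let $n$ be a positive odd integer with $\gcd(n,q)=1$ such that $q$ is a square modulo $n$. A splitting of $n$ given by $\mu_a$ ($a$ coprime to $n$) is a partition $\{1,\dots,n-1\}=S_0\sqcup S_1$ into sets that are closed under multiplication by $q$ modulo $n$ and satisfy $aS_0=S_1$ and $aS_1=S_0$ modulo $n$. For a splitting, a primitive $n$-th root of unity $\alpha$ in an algebraic closure of $\mathbf{F}_q$, and $i\in\{0,1\}$, the odd-like duadic code $D_i\subseteq\mathbf{F}_q^n$ is the cyclic code with defining set $S_i$, i.e. the set of $(c_0,\dots,c_{n-1})$ whose polynomial $\sum_k c_kx^k$ vanishes at $\alpha^j$ for all $j\in S_i$, and the even-like duadic code is $C_i=\{c\in D_i:\sum_k c_k=0\}$. The CSS construction assigns to $C_i\subset D_i$ the subspace $Q$ of $\mathbf{C}^{q^n}$ (with orthonormal basis $|x\rangle$, $x\in\mathbf{F}_q^n$) of all vectors fixed by $X(a)Z(b)$ for all $a\in C_i$, $b\in D_i^{\perp}$ (Euclidean dual), where $X(a)|x\rangle=|x+a\rangle$, $Z(b)|x\rangle=\omega^{\operatorname{tr}(b\cdot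 x)}|x\rangle$, $\omega=e^{2\pi i/p}$, $p=\operatorname{char}\mathbf{F}_q$, and $\operatorname{tr}$ is the trace from $\mathbf{F}_q$ to $\mathbf{F}_p$; call $Q$ a quantum duadic code. An $[[n,k,d]]_q$ code is a stabilizer code, i.e. a nonzero joint $+1$-eigenspace in $\mathbf{C}^{q^n}$ of a group of operators $\omega^cX(a)Z(b)$, that has dimension $q^k$ and minimum distance $d$: for every error $E=\omega^cX(a)Z(b)$ of weight $|\{k:(a_k,b_k)\ne(0,0)\}|<d$ one has $\langle u|E|u\rangle=\langle v|E|v\rangle$ for all unit vectors $u,v$ of the code, and this fails for some such error of weight $d$. Then quantum duadic codes exist, and each of them is an $[[n,1,d]]_q$ code for some $d$ with $d^2\ge n$. If moreover the multiplicative order $\operatorname{ord}_n(q)$ of $q$ modulo $n$ is odd, then there exist quantum duadic codes from splittings given by $\mu_{-1}$, and each of these is an $[[n,1,d]]_q$ code with $d^2-d+1\ge n$. -/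

import Mathlib

/-! ### Classical codes -/

/-- The Euclidean dual code `C^⊥ = {y | ∑ cᵢ yᵢ = 0 for all c ∈ C}`. -/
def dualCode {F : Type*} [Field F] {n : ℕ} (C : Submodule F (Fin n → F)) :
    Submodule F (Fin n → F) where
  carrier := {y | ∀ c ∈ C, ∑ i, c i * y i = 0}
  zero_mem' := by intro c _; simp
  add_mem' := by
    intro y z hy hz c hc
    have h1 := hy c hc
    have h2 := hz c hc
    simp only [Pi.add_apply, mul_add, Finset.sum_add_distrib, h1, h2, add_zero]
  smul_mem' := by
    intro r y hy c hc
    have h1 := hy c hc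
    simp only [Pi.smul_apply, smul_eq_mul, mul_left_comm _ r, ← Finset.mul_sum, h1, mul_zero]

/-- The cyclic code of length `n` over `F` with defining set `T ⊆ ℤ/n` relative to the `n`-th root
of unity `α`: the words `(c₀, …, cₙ₋₁)` whose polynomial `c(x) = ∑ cᵢ xⁱ` vanishes at `α ^ j`
for all `j ∈ T`. -/
def cyclicCode {F : Type*} [Field F] (n : ℕ) (α : AlgebraicClosure F) (T : Set (ZMod n)) :
    Submodule F (Fin n → F) where
  carrier := {c | ∀ j ∈ T,
    ∑ i : Fin n, algebraMap F (AlgebraicClosure F) (c i) * (α ^ j.val) ^ (i : ℕ) = 0}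
  zero_mem' := by intro j _; simp
  add_mem' := by
    intro c e hc he j hj
    have h1 := hc j hj
    have h2 := he j hj
    simp only [Pi.add_apply, map_add, add_mul, Finset.sum_add_distrib, h1, h2, add_zero]
  smul_mem' := by
    intro r c hc j hj
    have h1 := hc j hj
    simp only [Pi.smul_apply, smul_eq_mul, map_mul, mul_assoc, ← Finset.mul_sum, h1, mul_zero]

/-- The even-like subcode of `D`: the codewords with `∑ cᵢ = 0`. -/
def evenLikeSubcode {F : Type*} [Field F] {n : ℕ} (D : Submodule F (Fin n → F)) :
    Submodule F (Fin n → F) where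
  carrier := {c | c ∈ D ∧ ∑ i, c i = 0}
  zero_mem' := by simp
  add_mem' := by
    intro c e hc he
    exact ⟨D.add_mem hc.1 he.1, by
      simp only [Pi.add_apply, Finset.sum_add_distrib, hc.2, he.2, add_zero]⟩
  smul_mem' := by
    intro r c hc
    exact ⟨D.smul_mem r hc.1, by
      simp only [Pi.smul_apply, smul_eq_mul, ← Finset.mul_sum, hc.2, mul_zero]⟩

/-- `{S₀, S₁, a}` is a splitting of `n` over a field with `q` elements, given by the permutation
`μ_a : i ↦ a i` of `ℤ/n`. -/
structure IsSplitting (q n : ℕ) (S : Fin 2 → Set (ZMod n)) (a : (ZMod n)ˣ) : Prop where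
  /-- each `Sᵢ` is a union of `q`-ary cyclotomic cosets (a defining set of a cyclic code) -/
  cyclotomic : ∀ i, ∀ j ∈ S i, (q : ZMod n) * j ∈ S i
  disjoint : S 0 ∩ S 1 = ∅
  union : S 0 ∪ S 1 = {0}ᶜ
  /-- `a Sᵢ = S_{i+1 mod 2}` -/
  swap : ∀ i, (fun j => (a : ZMod n) * j) '' S i = S (i + 1)

/-- `C ⊂ D` are the even-like and the odd-like duadic code of length `n` over `F` belonging to one
of the two halves `Sᵢ` of a splitting given by `μ_a` and to some primitive `n`-th root of unity. -/
def IsDuadicPair {F : Type*} [Field F] [Fintype F] (n : ℕ) (a : (ZMod n)ˣ)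
    (C D : Submodule F (Fin n → F)) : Prop :=
  ∃ (S : Fin 2 → Set (ZMod n)) (α : AlgebraicClosure F) (i : Fin 2),
    IsSplitting (Fintype.card F) n S a ∧ IsPrimitiveRoot α n ∧
      D = cyclicCode n α (S i) ∧ C = evenLikeSubcode D

/-! ### Quantum codes

Throughout, `F` is a finite field of characteristic `p` (an algebra over `ZMod p`). -/

/-- The Hilbert space `ℂ^(q^n)`, with orthonormal basis `|x⟩` indexed by `x ∈ F^n`. -/
abbrev QSpace (F : Type*) [Fintype F] (n : ℕ) : Type _ := EuclideanSpace ℂ (Fin n → F)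

/-- The shift error `X(a) |x⟩ = |x + a⟩`. -/
noncomputable def shiftOp {F : Type*} [Field F] [Fintype F] {n : ℕ} (a : Fin n → F) :
    QSpace F n →ₗ[ℂ] QSpace F n where
  toFun v := WithLp.toLp 2 fun y => v (y - a)
  map_add' _ _ := rfl
  map_smul' _ _ := rfl

/-- The phase error `Z(b) |x⟩ = ω ^ tr(b·x) |x⟩`, where `ω = exp(2πi/p)` and `tr` is the trace
from `F` to the prime field. -/
noncomputable def phaseOp (p : ℕ) [Fact p.Prime] {F : Type*} [Field F] [Fintype F]
    [Algebra (ZMod p) F] {n : ℕ} (b : Fin n → F) : QSpace F n →ₗ[ℂ] QSpace F n where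
  toFun v := WithLp.toLp 2 fun y =>
    ZMod.stdAddChar (Algebra.trace (ZMod p) F (∑ i, b i * y i)) * v y
  map_add' v w := by ext y; simp [mul_add]
  map_smul' r v := by ext y; simp [mul_left_comm]

/-- The element `ω^c X(a) Z(b)` of the error group. -/
noncomputable def errorOp {p : ℕ} [Fact p.Prime] {F : Type*} [Field F] [Fintype F]
    [Algebra (ZMod p) F] {n : ℕ} (c : ZMod p) (a b : Fin n → F) :
    QSpace F n →ₗ[ℂ] QSpace F n :=
  (ZMod.stdAddChar c : ℂ) • (shiftOp a ∘ₗ phaseOp p b)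

/-- The weight of `ω^c X(a) Z(b)`: the number of tensor factors that are not scalar. -/
def errorWeight {F : Type*} [Field F] [DecidableEq F] {n : ℕ} (a b : Fin n → F) : ℕ :=
  hammingNorm fun i => (a i, b i)

/-- `Q` detects the error `E`: `⟨u|E|u⟩ = ⟨v|E|v⟩` for all states (unit vectors) `u, v` of `Q`. -/
def Detects {F : Type*} [Fintype F] {n : ℕ} (Q : Submodule ℂ (QSpace F n))
    (E : QSpace F n →ₗ[ℂ] QSpace F n) : Prop :=
  ∀ u ∈ Q, ∀ v ∈ Q, ‖u‖ = 1 → ‖v‖ = 1 → inner ℂ u (E u) = inner ℂ v (E v)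

/-- `Q` is a stabilizer code: a nonzero space that is the joint eigenspace with eigenvalue `1` of
a subgroup of the error group. -/
def IsStabilizerCode (p : ℕ) [Fact p.Prime] {F : Type*} [Field F] [Fintype F]
    [Algebra (ZMod p) F] {n : ℕ} (Q : Submodule ℂ (QSpace F n)) : Prop :=
  Q ≠ ⊥ ∧ ∃ G : Subgroup (LinearMap.GeneralLinearGroup ℂ (QSpace F n)),
    (∀ g ∈ G, ∃ (c : ZMod p) (a b : Fin n → F),
      (g : QSpace F n →ₗ[ℂ] QSpace F n) = errorOp c a b) ∧
    ∀ v, v ∈ Q ↔ ∀ g ∈ G, (g : QSpace F n →ₗ[ℂ] QSpace F n) v = v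

/-- `Q` is an `[[n, k, d]]_q` stabilizer code with (exact) minimum distance `d`: it has dimension
`q^k`, detects all errors of weight less than `d`, and fails to detect some error of weight `d`. -/
structure IsQuantumCode (p : ℕ) [Fact p.Prime] {F : Type*} [Field F] [Fintype F] [DecidableEq F]
    [Algebra (ZMod p) F] {n : ℕ} (Q : Submodule ℂ (QSpace F n)) (k d : ℕ) : Prop where
  stabilizer : IsStabilizerCode p Q
  dim : Module.finrank ℂ Q = Fintype.card F ^ k
  detects : ∀ (c : ZMod p) (a b : Fin n → F), errorWeight a b < d → Detects Q (errorOp c a b)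
  sharp : ∃ (c : ZMod p) (a b : Fin n → F), errorWeight a b = d ∧ ¬ Detects Q (errorOp c a b)

/-- The CSS construction for `C ⊂ D`: the joint eigenspace with eigenvalue `1` of all `X(a) Z(b)`
with `a ∈ C` and `b ∈ D^⊥`. -/
def cssCode (p : ℕ) [Fact p.Prime] {F : Type*} [Field F] [Fintype F]
    [Algebra (ZMod p) F] {n : ℕ} (C D : Submodule F (Fin n → F)) :
    Submodule ℂ (QSpace F n) where
  carrier := {v | ∀ a ∈ C, ∀ b ∈ dualCode D, (shiftOp a ∘ₗ phaseOp p b) v = v}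
  zero_mem' := by intro a _ b _; exact map_zero _
  add_mem' := by intro v w hv hw a ha b hb; rw [map_add, hv a ha b hb, hw a ha b hb]
  smul_mem' := by intro r v hv a ha b hb; rw [map_smul, hv a ha b hb]

/-- `Q` is a quantum duadic code with splitting given by `μ_a`: it arises by the CSS construction
from an even-like and an odd-like duadic code `C ⊂ D` belonging to such a splitting. -/
def IsQuantumDuadicCode (p : ℕ) [Fact p.Prime] {F : Type*} [Field F] [Fintype F]
    [Algebra (ZMod p) F] {n : ℕ} (a : (ZMod n)ˣ) (Q : Submodule ℂ (QSpace F n)) : Prop :=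
  ∃ C D : Submodule F (Fin n → F), IsDuadicPair n a C D ∧ Q = cssCode p C D

/-! Let `C ⊂ D` be a duadic pair with defining set `S i`. As `0 ∉ S i`, the all-ones word lies in
`D`, and as `n` is invertible in `F`, `D = C ⊕ F·1`. The CSS code consists of the functions
supported on `D` and constant on cosets of `C`, that is, functions on `D/C ≅ F` via the coordinate
sum; so its dimension is `q` (`finrank_cssCode`). An error `X(a)Z(b)` with `a ∉ D` or `b ∉ C^⊥` has
expectation zero on the code, and one with `a ∈ C`, `b ∈ D^⊥` acts as a scalar. In every other case
`a ∈ D` or `b ∈ C^⊥` is odd-like (nonzero coordinate sum). Hence the distance is the least weight of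
an odd-like word in `D ∪ C^⊥` (`exists_isQuantumCode_cssCode`). Such a word `c` obeys a square root
bound (`le_hammingNorm_sq`). The spectrum of `c(x)` times that of its dilate under `μ_a` vanishes
off `0`, so their cyclic convolution is a nonzero constant and every class is `i + a k` with `i`,
`k` in the support. Counting pairs gives `n ≤ d²`; for `a = -1` the `d` diagonal pairs all give `0`,
so `n ≤ d² - d + 1`. The bound covers `C^⊥` because its words have zeros on `-S (i + 1)`, which
satisfies the same covering condition. Splittings come from two-colourings of the nonzero classes:
by quadratic characters in general, and by comparing the cosets of `j` and `-j` when the order of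
`q` is odd. -/

/-! ### Existence of splittings -/

/-- A colouring of `ℤ/n` that is constant on cyclotomic cosets and flipped by `μ_a` on the nonzero
classes yields a splitting given by `μ_a`. -/
theorem exists_isSplitting_of_coloring {q n : ℕ} (hq : Nat.Coprime q n) (a : (ZMod n)ˣ)
    (P : ZMod n → Prop) (hPq : ∀ j, j ≠ 0 → P j → P (q * j))
    (hPq' : ∀ j, j ≠ 0 → P (q * j) → P j)
    (hPa : ∀ j, j ≠ 0 → (P (a * j) ↔ ¬ P j)) :
    ∃ S, IsSplitting q n S a := by
  have hqu : ∀ j : ZMod n, j ≠ 0 → (q : ZMod n) * j ≠ 0 := by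
    intro j hj h
    have := ZMod.coe_unitOfCoprime q hq
    rw [← this] at h
    exact hj ((Units.mul_right_eq_zero _).1 h)
  have hau : ∀ j : ZMod n, j ≠ 0 → (a : ZMod n) * j ≠ 0 := fun j hj h =>
    hj ((Units.mul_right_eq_zero _).1 h)
  have hai : ∀ j : ZMod n, j ≠ 0 → ((a⁻¹ : (ZMod n)ˣ) : ZMod n) * j ≠ 0 := fun j hj h =>
    hj ((Units.mul_right_eq_zero _).1 h)
  have hPi : ∀ j, j ≠ 0 → (P ((a⁻¹ : (ZMod n)ˣ) * j) ↔ ¬ P j) := by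
    intro j hj
    have := hPa _ (hai j hj)
    rw [Units.mul_inv_cancel_left] at this
    tauto
  refine ⟨![{j | j ≠ 0 ∧ P j}, {j | j ≠ 0 ∧ ¬ P j}], ?_, ?_, ?_, ?_⟩
  · intro i j hj
    fin_cases i
    · exact ⟨hqu j hj.1, hPq j hj.1 hj.2⟩
    · exact ⟨hqu j hj.1, fun h => hj.2 (hPq' j hj.1 h)⟩
  · ext j
    simp only [Matrix.cons_val_zero, Matrix.cons_val_one, Set.mem_inter_iff, Set.mem_ofPred_eq,
      Set.mem_empty_iff_false]
    tauto
  · ext j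
    simp only [Matrix.cons_val_zero, Matrix.cons_val_one, Set.mem_union, Set.mem_ofPred_eq,
      Set.mem_compl_iff, Set.mem_singleton_iff]
    tauto
  · intro i
    fin_cases i
    · ext j
      constructor
      · rintro ⟨k, hk, rfl⟩
        exact ⟨hau k hk.1, fun h => (hPa k hk.1).1 h hk.2⟩
      · intro hj
        exact ⟨(a⁻¹ : (ZMod n)ˣ) * j, ⟨hai j hj.1, (hPi j hj.1).2 hj.2⟩,
          Units.mul_inv_cancel_left _ _⟩
    · ext j
      constructor
      · rintro ⟨k, hk, rfl⟩
        exact ⟨hau k hk.1, (hPa k hk.1).2 hk.2⟩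
      · intro hj
        exact ⟨(a⁻¹ : (ZMod n)ˣ) * j, ⟨hai j hj.1, fun h => (hPi j hj.1).1 h hj.2⟩,
          Units.mul_inv_cancel_left _ _⟩

/-- The smallest prime factor of the additive order of a class in `ℤ/n`. -/
def orderMinFac (n : ℕ) (j : ZMod n) : ℕ := (n / Nat.gcd j.val n).minFac

/-- The Jacobi symbol of a class in `ℤ/n` with its common factor with `n` removed, modulo the
smallest prime factor of its additive order. -/
def residueSign (n : ℕ) (j : ZMod n) : ℤ :=
  jacobiSym ((j.val / Nat.gcd j.val n : ℕ) : ℤ) (orderMinFac n j)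

theorem orderMinFac_prime_dvd {n : ℕ} [NeZero n] {j : ZMod n} (hj : j ≠ 0) :
    (orderMinFac n j).Prime ∧ orderMinFac n j ∣ n := by
  have hn : 0 < n := NeZero.pos n
  refine ⟨Nat.minFac_prime ?_, (Nat.minFac_dvd _).trans
    (Nat.div_dvd_of_dvd (Nat.gcd_dvd_right _ _))⟩
  intro h
  have h1 : n ∣ j.val := by
    have h2 := Nat.div_mul_cancel (Nat.gcd_dvd_right j.val n)
    rw [h, one_mul] at h2
    exact Nat.gcd_eq_right_iff_dvd.1 h2
  have h3 : j.val ≠ 0 := by rwa [Ne, ZMod.val_eq_zero]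
  exact absurd (Nat.le_of_dvd (Nat.pos_of_ne_zero h3) h1) (not_le.2 (ZMod.val_lt j))

theorem residueSign_ne_zero {n : ℕ} [NeZero n] (j : ZMod n) :
    residueSign n j ≠ 0 := by
  have hn : 0 < n := NeZero.pos n
  refine jacobiSym.ne_zero ?_
  rw [Int.gcd_natCast_natCast]
  exact (Nat.coprime_div_gcd_div_gcd (Nat.gcd_pos_of_pos_right _ hn)).coprime_dvd_right
    (Nat.minFac_dvd _)

/-- A unit preserves `gcd(j, n)`, hence the additive order and the prime chosen from it, and
multiplies the reduced numerator by `u` modulo that order. Any prime factor depending only on the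
order would serve as well as the smallest. -/
theorem residueSign_mul {n : ℕ} [NeZero n] {u : ℕ} (hu : Nat.Coprime u n) (j : ZMod n) :
    residueSign n (u * j) = jacobiSym u (orderMinFac n j) * residueSign n j := by
  have hn : 0 < n := NeZero.pos n
  have hval : ((u : ZMod n) * j).val = (u * j.val) % n := by
    rw [ZMod.val_mul, ZMod.val_natCast, Nat.mod_mul_mod]
  have hgcd : Nat.gcd ((u : ZMod n) * j).val n = Nat.gcd j.val n := by
    rw [hval, ← Nat.gcd_rec, Nat.gcd_comm, Nat.Coprime.gcd_mul_left_cancel _ hu]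
  unfold residueSign orderMinFac
  rw [hgcd, hval, ← jacobiSym.mul_left]
  obtain ⟨x, hx⟩ := Nat.gcd_dvd_left j.val n
  obtain ⟨d, hd⟩ := Nat.gcd_dvd_right j.val n
  have hg : 0 < Nat.gcd j.val n := Nat.gcd_pos_of_pos_right _ hn
  have h1 : j.val / Nat.gcd j.val n = x := Nat.div_eq_of_eq_mul_right hg hx
  have h2 : n / Nat.gcd j.val n = d := Nat.div_eq_of_eq_mul_right hg hd
  have h3 : (u * j.val) % n / Nat.gcd j.val n = (u * x) % d := by
    refine Nat.div_eq_of_eq_mul_right hg ?_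
    generalize Nat.gcd j.val n = g at *
    rw [hx, hd, Nat.mul_left_comm, Nat.mul_mod_mul_left]
  rw [h1, h2, h3, ← Nat.cast_mul]
  refine jacobiSym.mod_left' ?_
  exact_mod_cast Nat.mod_mod_of_dvd _ (Nat.minFac_dvd d)

/-- Over an odd modulus there is a residue that is a nonsquare modulo every prime divisor. -/
theorem exists_nonresidue_all_primes {n : ℕ} (hn : Odd n) :
    ∃ u : ℕ, ∀ p, p.Prime → p ∣ n → jacobiSym u p = -1 := by
  have hn0 : n ≠ 0 := hn.pos.ne'
  have key : ∀ p : ℕ, ∃ u : ℕ, p.Prime → p ∣ n → jacobiSym u p = -1 := by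
    intro p
    by_cases hp : p.Prime ∧ p ∣ n
    · have : Fact p.Prime := ⟨hp.1⟩
      have hp2 : ringChar (ZMod p) ≠ 2 := by
        rw [ZMod.ringChar_zmod_n]
        rintro rfl
        exact (Nat.not_even_iff_odd.2 hn) (even_iff_two_dvd.2 hp.2)
      obtain ⟨a, ha⟩ := FiniteField.exists_nonsquare hp2
      refine ⟨a.val, fun _ _ => ZMod.nonsquare_iff_jacobiSym_eq_neg_one.2 ?_⟩
      simpa using ha
    · exact ⟨0, fun h1 h2 => absurd ⟨h1, h2⟩ hp⟩
  choose f hf using key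
  obtain ⟨u, hu⟩ := Nat.chineseRemainderOfFinset f id n.primeFactors
    (fun i hi => (Nat.prime_of_mem_primeFactors hi).ne_zero)
    (fun i hi j hj hij => (Nat.coprime_primes (Nat.prime_of_mem_primeFactors hi)
      (Nat.prime_of_mem_primeFactors hj)).2 hij)
  refine ⟨u, fun p hp hpn => ?_⟩
  rw [← hf p hp hpn]
  have := hu p (Nat.mem_primeFactors.2 ⟨hp, hpn, hn0⟩)
  refine jacobiSym.mod_left' ?_
  exact_mod_cast this

/-- Colour `j` by `residueSign`. Being a square modulo every prime factor of `n`, `q` preserves the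
colour; a multiplier `u` that is a nonsquare modulo all of them flips it. -/
theorem exists_isSplitting {q n : ℕ} (hn : Odd n) (hq : Nat.Coprime q n)
    (hsq : IsSquare (q : ZMod n)) :
    ∃ (a : (ZMod n)ˣ) (S : Fin 2 → Set (ZMod n)), IsSplitting q n S a := by
  have : NeZero n := ⟨hn.pos.ne'⟩
  obtain ⟨u, hu⟩ := exists_nonresidue_all_primes hn
  have hun : Nat.Coprime u n := by
    refine Nat.Coprime.symm (Nat.coprime_of_dvd fun p hp hpn hpu => ?_)
    have h := hu p hp hpn
    have h0 : jacobiSym u p = 0 := by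
      refine jacobiSym.eq_zero_iff.2 ⟨hp.ne_zero, ?_⟩
      rw [Int.gcd_natCast_natCast, Nat.gcd_eq_right hpu]
      exact hp.ne_one
    rw [h0] at h
    norm_num at h
  have hqp : ∀ p, p.Prime → p ∣ n → jacobiSym q p = 1 := by
    intro p hp hpn
    have : Fact p.Prime := ⟨hp⟩
    have h1 : IsSquare ((q : ℤ) : ZMod p) := by
      have := hsq.map (ZMod.castHom hpn (ZMod p))
      simpa using this
    rcases jacobiSym.eq_one_or_neg_one (a := q) (b := p) (by
      rw [Int.gcd_natCast_natCast]; exact hq.coprime_dvd_right hpn) with h | h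
    · exact h
    · exact absurd h1 (ZMod.nonsquare_iff_jacobiSym_eq_neg_one.1 h)
  refine ⟨ZMod.unitOfCoprime u hun, exists_isSplitting_of_coloring hq _
    (fun j => residueSign n j = 1) ?_ ?_ ?_⟩
  · intro j hj h
    obtain ⟨hp, hpn⟩ := orderMinFac_prime_dvd hj
    rw [residueSign_mul hq, hqp _ hp hpn, h, one_mul]
  · intro j hj h
    obtain ⟨hp, hpn⟩ := orderMinFac_prime_dvd hj
    rwa [residueSign_mul hq, hqp _ hp hpn, one_mul] at h
  · intro j hj
    obtain ⟨hp, hpn⟩ := orderMinFac_prime_dvd hj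
    rw [ZMod.coe_unitOfCoprime, residueSign_mul hun, hu _ hp hpn]
    have h0 := residueSign_ne_zero j
    have h1 : residueSign n j = 0 ∨ residueSign n j = 1 ∨ residueSign n j = -1 :=
      jacobiSym.trichotomy _ _
    omega

/-- The smallest representative of the cyclotomic coset of a class in `ℤ/n`. -/
noncomputable def cosetLeader (q n : ℕ) (j : ZMod n) : ℕ :=
  sInf (Set.range fun k : ℕ => ((q : ZMod n) ^ k * j).val)

/-- Odd order of `q` keeps `j` and `-j` in different cosets, so whichever has the smaller leader
gives a colouring that negation flips. -/
theorem exists_isSplitting_neg_one {q n : ℕ} (hn : Odd n) (hq : Nat.Coprime q n)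
    (hord : Odd (orderOf (q : ZMod n))) :
    ∃ S : Fin 2 → Set (ZMod n), IsSplitting q n S (-1) := by
  have : NeZero n := ⟨hn.pos.ne'⟩
  obtain ⟨r, hr⟩ := hord
  have hqr : (q : ZMod n) ^ (2 * r + 1) = 1 := by rw [← hr]; exact pow_orderOf_eq_one _
  have hmul : ∀ j, cosetLeader q n (q * j) = cosetLeader q n j := by
    intro j
    unfold cosetLeader
    congr 1
    ext m
    constructor
    · rintro ⟨k, rfl⟩
      exact ⟨k + 1, by simp only [pow_succ, mul_assoc]⟩
    · rintro ⟨k, rfl⟩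
      -- `q ^ (2 * r)` is the inverse of `q`.
      refine ⟨k + 2 * r, ?_⟩
      have : (q : ZMod n) ^ (k + 2 * r) * (q * j) = q ^ k * j * q ^ (2 * r + 1) := by ring
      simp only [this, hqr, mul_one]
  have hne : ∀ j, j ≠ 0 → cosetLeader q n j ≠ cosetLeader q n (-j) := by
    intro j hj h
    obtain ⟨k, hk⟩ := Nat.sInf_mem (Set.range_nonempty fun k : ℕ => ((q : ZMod n) ^ k * j).val)
    obtain ⟨l, hl⟩ := Nat.sInf_mem (Set.range_nonempty fun k : ℕ => ((q : ZMod n) ^ k * -j).val)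
    have h1 : (q : ZMod n) ^ k * j = q ^ l * -j := by
      apply ZMod.val_injective
      exact hk.trans (h.trans hl.symm)
    -- Equal leaders force `-q^N` to fix `j` for some `N`. Its power of odd exponent `2 * r + 1` is
    -- `-1`, so `-j = j`, which is impossible for `j ≠ 0` and odd `n`.
    have h2 : -(q : ZMod n) ^ (2 * r * k + l) * j = j :=
      calc -(q : ZMod n) ^ (2 * r * k + l) * j = q ^ (2 * r * k) * (q ^ l * -j) := by ring
        _ = (q ^ (2 * r + 1)) ^ k * j := by rw [← h1]; ring
        _ = j := by rw [hqr, one_pow, one_mul]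
    have h3 : ∀ N : ℕ, (-(q : ZMod n) ^ (2 * r * k + l)) ^ N * j = j := by
      intro N
      induction N with
      | zero => simp
      | succ N ih => rw [pow_succ, mul_assoc, h2, ih]
    have h4 := h3 (2 * r + 1)
    rw [Odd.neg_pow ⟨r, rfl⟩, ← pow_mul, mul_comm, mul_comm (2 * r * k + l), pow_mul, hqr,
      one_pow, mul_neg, mul_one] at h4
    exact hj ((ZMod.neg_eq_self_iff j).1 h4 |>.resolve_right fun h5 => by
      obtain ⟨m, hm⟩ := hn
      omega)
  refine exists_isSplitting_of_coloring hq _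
    (fun j => cosetLeader q n j < cosetLeader q n (-j)) ?_ ?_ ?_
  · intro j _ h
    rwa [← mul_neg, hmul, hmul]
  · intro j _ h
    rwa [← mul_neg, hmul, hmul] at h
  · intro j hj
    have := hne j hj
    simp only [Units.val_neg, Units.val_one, neg_mul, one_mul, neg_neg]
    omega

/-! ### Fourier analysis on `ℤ/n` and the square root bound -/

open Polynomial in
/-- An element of an extension of a finite field fixed by the Frobenius map lies in that field. -/
theorem FiniteField.mem_range_algebraMap_of_pow_card_eq {F L : Type*} [Field F] [Fintype F]
    [Field L] [Algebra F L] {y : L} (hy : y ^ Fintype.card F = y) :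
    y ∈ Set.range (algebraMap F L) := by
  have hs : (X ^ Fintype.card F - X : F[X]).Splits := by
    rw [splits_iff_card_roots, FiniteField.roots_X_pow_card_sub_X,
      FiniteField.X_pow_card_sub_X_natDegree_eq _ Fintype.one_lt_card]
    rfl
  have hr := hs.roots_map (algebraMap F L)
  have hmem : y ∈ ((X ^ Fintype.card F - X : F[X]).map (algebraMap F L)).roots := by
    rw [mem_roots (by
      rw [Polynomial.map_ne_zero_iff (algebraMap F L).injective]
      exact FiniteField.X_pow_card_sub_X_ne_zero _ Fintype.one_lt_card)]
    simp [IsRoot, hy]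
  rw [hr] at hmem
  obtain ⟨x, -, hx⟩ := Multiset.mem_map.1 hmem
  exact ⟨x, hx⟩

theorem sum_fin_natCast {n : ℕ} [NeZero n] {M : Type*} [AddCommMonoid M] (f : ZMod n → M) :
    ∑ i : Fin n, f ((i : ℕ) : ZMod n) = ∑ j, f j := by
  refine Fintype.sum_bijective (fun i : Fin n => ((i : ℕ) : ZMod n)) ?_ _ _ fun _ => rfl
  rw [Fintype.bijective_iff_injective_and_card, ZMod.card, Fintype.card_fin]
  refine ⟨fun i k h => Fin.ext ?_, rfl⟩
  have h1 := congrArg ZMod.val h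
  rwa [ZMod.val_cast_of_lt i.2, ZMod.val_cast_of_lt k.2] at h1

/-- The power-sum character `j ↦ ∑ i, c i * ψ (j i)` of a word of length `n`. -/
noncomputable def wordTransform {n : ℕ} {L : Type*} [Field L] (ψ : AddChar (ZMod n) L)
    (c : Fin n → L) (j : ZMod n) : L :=
  ∑ i : Fin n, c i * ψ (j * (i : ℕ))

/-- Fourier inversion: summing the transform against `ψ (-(j * t))` recovers `n * g j` by
orthogonality. -/
theorem AddChar.IsPrimitive.injective_transform {n : ℕ} [NeZero n] {L : Type*} [Field L]
    {ψ : AddChar (ZMod n) L} (hψ : ψ.IsPrimitive) (hn : (n : L) ≠ 0) {g : ZMod n → L}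
    (hg : ∀ t, ∑ j, g j * ψ (j * t) = 0) (j : ZMod n) : g j = 0 := by
  have h : ∑ t, (∑ k, g k * ψ (k * t)) * ψ (-(j * t)) = n * g j := by
    simp only [Finset.sum_mul]
    rw [Finset.sum_comm]
    have : ∀ k, ∑ t, g k * ψ (k * t) * ψ (-(j * t)) = if k = j then n * g j else 0 := by
      intro k
      have h1 := AddChar.sum_mulShift (k - j) hψ
      rw [ZMod.card] at h1
      calc ∑ t, g k * ψ (k * t) * ψ (-(j * t)) = g k * ∑ t, ψ (t * (k - j)) := by
            rw [Finset.mul_sum]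
            refine Finset.sum_congr rfl fun t _ => ?_
            rw [mul_assoc, ← AddChar.map_add_eq_mul]
            congr 2
            ring
        _ = _ := by
          rw [h1]
          by_cases hk : k = j
          · subst hk; simp [mul_comm]
          · simp [hk, sub_eq_zero]
    simp [this]
  simp only [hg, zero_mul, Finset.sum_const_zero] at h
  exact (mul_eq_zero.1 h.symm).resolve_left hn

/-- If the product of the transforms of `c` and of its `a`-dilate is supported at `0` and nonzero
there, then every class is of the form `i + a k` with `i`, `k` in the support of `c`. -/
theorem exists_support_add_mul {n : ℕ} [NeZero n] {L : Type*} [Field L]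
    {ψ : AddChar (ZMod n) L} (hψ : ψ.IsPrimitive) (hn : (n : L) ≠ 0) {c : Fin n → L}
    (a : ZMod n) (h0 : ∑ i, c i ≠ 0)
    (h : ∀ j ≠ 0, wordTransform ψ c j * wordTransform ψ c (a * j) = 0) (m : ZMod n) :
    ∃ i k : Fin n, c i ≠ 0 ∧ c k ≠ 0 ∧ ((i : ℕ) : ZMod n) + a * ((k : ℕ) : ZMod n) = m := by
  by_contra! hm
  -- `P` is the cyclic convolution of `c` with its `a`-dilate; `hPt` is the convolution theorem.
  set P : ZMod n → L := fun m => ∑ x : Fin n × Fin n,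
    if ((x.1 : ℕ) : ZMod n) + a * ((x.2 : ℕ) : ZMod n) = m then c x.1 * c x.2 else 0 with hP
  have hPt : ∀ j, ∑ m, P m * ψ (m * j) = wordTransform ψ c j * wordTransform ψ c (a * j) := by
    intro j
    rw [wordTransform, wordTransform, Finset.sum_mul_sum]
    simp only [hP, Finset.sum_mul]
    rw [Finset.sum_comm, Fintype.sum_prod_type]
    refine Finset.sum_congr rfl fun i _ => Finset.sum_congr rfl fun k _ => ?_
    simp only [ite_mul, zero_mul, Finset.sum_ite_eq, Finset.mem_univ, if_true]
    rw [mul_mul_mul_comm, ← AddChar.map_add_eq_mul]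
    congr 2
    ring
  have hPm : P m = 0 := Finset.sum_eq_zero fun x _ => by
    by_cases hx : ((x.1 : ℕ) : ZMod n) + a * ((x.2 : ℕ) : ZMod n) = m
    · rw [if_pos hx]
      by_cases h1 : c x.1 = 0
      · rw [h1, zero_mul]
      · by_cases h2 : c x.2 = 0
        · rw [h2, mul_zero]
        · exact absurd hx (hm _ _ h1 h2)
    · rw [if_neg hx]
  have hw0 : wordTransform ψ c 0 = ∑ i, c i := by simp [wordTransform]
  -- The constant `n⁻¹ (∑ c)²` has the same transform as `P`: zero off `0` and `(∑ c)²` at `0`. So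
  -- `P` equals this nonzero constant everywhere, against `P m = 0`.
  have hg := hψ.injective_transform hn
    (g := fun m => P m - ((n : L)⁻¹ * (∑ i, c i) ^ 2)) (fun t => by
      have h1 := AddChar.sum_mulShift t hψ
      rw [ZMod.card] at h1
      simp only [sub_mul, Finset.sum_sub_distrib, hPt, ← Finset.mul_sum, h1]
      by_cases ht : t = 0
      · subst ht
        rw [mul_zero, hw0, if_pos rfl]
        field_simp
        ring
      · simp [ht, h t ht]) m
  rw [hPm, zero_sub, neg_eq_zero] at hg
  exact mul_ne_zero (inv_ne_zero hn) (pow_ne_zero 2 h0) hg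

theorem le_hammingNorm_sq_of_surj {n : ℕ} [NeZero n] {L : Type*} [Field L] [DecidableEq L]
    {c : Fin n → L} (a : ZMod n)
    (h : ∀ m : ZMod n, ∃ i k : Fin n, c i ≠ 0 ∧ c k ≠ 0 ∧
      ((i : ℕ) : ZMod n) + a * ((k : ℕ) : ZMod n) = m) :
    n ≤ hammingNorm c ^ 2 := by
  set s : Finset (Fin n) := {i | c i ≠ 0}
  have : (Finset.univ : Finset (ZMod n)) ⊆
      (s ×ˢ s).image fun x => ((x.1 : ℕ) : ZMod n) + a * ((x.2 : ℕ) : ZMod n) := by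
    intro m _
    obtain ⟨i, k, hi, hk, rfl⟩ := h m
    exact Finset.mem_image.2 ⟨(i, k), by simp [s, hi, hk], rfl⟩
  have h2 := (Finset.card_le_card this).trans Finset.card_image_le
  rw [Finset.card_univ, ZMod.card, Finset.card_product] at h2
  rw [sq]
  exact h2

/-- Diagonal pairs contribute only the difference `0`, so only the `w² - w` off-diagonal pairs and
that one class count. -/
theorem le_hammingNorm_sq_sub_of_surj {n : ℕ} [NeZero n] {L : Type*} [Field L] [DecidableEq L]
    {c : Fin n → L}
    (h : ∀ m : ZMod n, ∃ i k : Fin n, c i ≠ 0 ∧ c k ≠ 0 ∧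
      ((i : ℕ) : ZMod n) + (-1) * ((k : ℕ) : ZMod n) = m) :
    (n : ℤ) ≤ (hammingNorm c : ℤ) ^ 2 - hammingNorm c + 1 := by
  set s : Finset (Fin n) := {i | c i ≠ 0}
  have : (Finset.univ : Finset (ZMod n)) ⊆
      insert 0 (s.offDiag.image fun x => ((x.1 : ℕ) : ZMod n) + (-1) * ((x.2 : ℕ) : ZMod n)) := by
    intro m _
    obtain ⟨i, k, hi, hk, rfl⟩ := h m
    by_cases hik : i = k
    · subst hik; simp
    · exact Finset.mem_insert_of_mem
        (Finset.mem_image.2 ⟨(i, k), by simp [s, hi, hk, hik], rfl⟩)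
  have h2 := (Finset.card_le_card this).trans ((Finset.card_insert_le _ _).trans
    (Nat.add_le_add_right Finset.card_image_le 1))
  rw [Finset.card_univ, ZMod.card, Finset.offDiag_card] at h2
  have h3 : s.card ≤ s.card * s.card := Nat.le_mul_self _
  have h4 : hammingNorm c = s.card := rfl
  rw [h4, sq]
  zify [h3] at h2
  exact h2

theorem natCast_ne_zero_of_coprime_card {F : Type*} [Field F] [Fintype F] {n : ℕ}
    (h : Nat.Coprime (Fintype.card F) n) : (n : F) ≠ 0 := by
  obtain ⟨p, hp⟩ := CharP.exists F
  have : Fact p.Prime := ⟨CharP.char_is_prime F p⟩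
  obtain ⟨m, -, hm⟩ := FiniteField.card F p
  rw [Ne, CharP.cast_eq_zero_iff F p]
  intro hpn
  rw [hm] at h
  exact (CharP.char_is_prime F p).one_lt.ne' (Nat.Coprime.eq_one_of_dvd
    (Nat.Coprime.coprime_dvd_left (dvd_pow_self p m.ne_zero) h) hpn)

/-- The additive character `j ↦ α ^ j` of `ℤ/n` attached to a primitive `n`-th root of unity. -/
noncomputable def rootChar {n : ℕ} [NeZero n] {L : Type*} [Field L] {α : L}
    (hα : IsPrimitiveRoot α n) : AddChar (ZMod n) L :=
  AddChar.zmodChar n hα.pow_eq_one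

theorem rootChar_isPrimitive {n : ℕ} [NeZero n] {L : Type*} [Field L] {α : L}
    (hα : IsPrimitiveRoot α n) : (rootChar hα).IsPrimitive :=
  AddChar.zmodChar_primitive_of_primitive_root n hα

theorem mem_cyclicCode_iff {F : Type*} [Field F] {n : ℕ} [NeZero n] {α : AlgebraicClosure F}
    (hα : IsPrimitiveRoot α n) {T : Set (ZMod n)} {c : Fin n → F} :
    c ∈ cyclicCode n α T ↔
      ∀ j ∈ T, wordTransform (rootChar hα) (fun i => algebraMap F (AlgebraicClosure F) (c i)) j
        = 0 := by
  have h : ∀ j : ZMod n, ∑ i : Fin n, algebraMap F (AlgebraicClosure F) (c i) *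
      (α ^ j.val) ^ (i : ℕ) = wordTransform (rootChar hα)
        (fun i => algebraMap F (AlgebraicClosure F) (c i)) j := by
    intro j
    refine Finset.sum_congr rfl fun i _ => ?_
    have : j * ((i : ℕ) : ZMod n) = (i : ℕ) • j := by rw [nsmul_eq_mul, mul_comm]
    rw [this, AddChar.map_nsmul_eq_pow, rootChar, AddChar.zmodChar_apply]
  constructor
  · intro hc j hj
    rw [← h]
    exact hc j hj
  · intro hc j hj
    rw [h]
    exact hc j hj

/-- The square root bound for words whose spectrum vanishes on a set `T` with
`T ∪ a⁻¹ T ⊇ ℤ/n \ {0}` but not at `0`. -/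
theorem le_hammingNorm_sq {F : Type*} [Field F] [DecidableEq F] {n : ℕ} [NeZero n]
    (hn : (n : F) ≠ 0) {α : AlgebraicClosure F} (hα : IsPrimitiveRoot α n) {T : Set (ZMod n)}
    {c : Fin n → F} (hc : c ∈ cyclicCode n α T) (h0 : ∑ i, c i ≠ 0) {a : (ZMod n)ˣ}
    (hT : ∀ j ≠ 0, j ∈ T ∨ (a : ZMod n) * j ∈ T) :
    n ≤ hammingNorm c ^ 2 ∧
      (a = -1 → (n : ℤ) ≤ (hammingNorm c : ℤ) ^ 2 - hammingNorm c + 1) := by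
  classical
  have hinj := (algebraMap F (AlgebraicClosure F)).injective
  have hn' : (n : AlgebraicClosure F) ≠ 0 := by
    rw [← map_natCast (algebraMap F (AlgebraicClosure F))]
    exact (map_ne_zero_iff _ hinj).2 hn
  rw [mem_cyclicCode_iff hα] at hc
  have key : ∀ m : ZMod n, ∃ i k : Fin n, c i ≠ 0 ∧ c k ≠ 0 ∧
      ((i : ℕ) : ZMod n) + (a : ZMod n) * ((k : ℕ) : ZMod n) = m := by
    intro m
    obtain ⟨i, k, hi, hk, h⟩ := exists_support_add_mul (rootChar_isPrimitive hα) hn'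
      (c := fun i => algebraMap F (AlgebraicClosure F) (c i)) (a : ZMod n) (by
        rw [← map_sum]
        exact (map_ne_zero_iff _ hinj).2 h0) (fun j hj => by
        rcases hT j hj with h | h
        · rw [hc _ h, zero_mul]
        · rw [hc _ h, mul_zero]) m
    exact ⟨i, k, (map_ne_zero_iff _ hinj).1 hi, (map_ne_zero_iff _ hinj).1 hk, h⟩
  refine ⟨le_hammingNorm_sq_of_surj _ key, ?_⟩
  rintro rfl
  exact le_hammingNorm_sq_sub_of_surj (by simpa using key)

/-! ### Splittings and the dual of an even-like duadic code -/

theorem IsSplitting.mem_or_mul_mem {q n : ℕ} {S : Fin 2 → Set (ZMod n)} {a : (ZMod n)ˣ}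
    (h : IsSplitting q n S a) (i : Fin 2) {j : ZMod n} (hj : j ≠ 0) :
    j ∈ S i ∨ (a : ZMod n) * j ∈ S i := by
  have hu : j ∈ S i ∨ j ∈ S (i + 1) := by
    have : j ∈ S 0 ∪ S 1 := by rw [h.union]; exact hj
    fin_cases i
    · exact this
    · exact this.symm
  refine hu.imp_right fun h1 => ?_
  have h2 := h.swap (i + 1)
  have h3 : i + 1 + 1 = i := by fin_cases i <;> rfl
  rw [h3] at h2
  rw [← h2]
  exact ⟨j, h1, rfl⟩

theorem IsSplitting.ne_zero_of_mem {q n : ℕ} {S : Fin 2 → Set (ZMod n)} {a : (ZMod n)ˣ}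
    (h : IsSplitting q n S a) {i : Fin 2} {j : ZMod n} (hj : j ∈ S i) : j ≠ 0 := by
  have : j ∈ S 0 ∪ S 1 := by
    fin_cases i
    · exact Or.inl hj
    · exact Or.inr hj
  rw [h.union] at this
  exact this

theorem IsSplitting.notMem_of_mem {q n : ℕ} {S : Fin 2 → Set (ZMod n)} {a : (ZMod n)ˣ}
    (h : IsSplitting q n S a) {i : Fin 2} {j : ZMod n} (hj : j ∈ S (i + 1)) : j ∉ S i := by
  intro hi
  have : j ∈ S 0 ∩ S 1 := by
    fin_cases i
    · exact ⟨hi, hj⟩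
    · exact ⟨hj, hi⟩
  rw [h.disjoint] at this
  exact this

/-- Character sums over a union of cyclotomic cosets have values in the base field. -/
theorem sum_rootChar_mem_range {F : Type*} [Field F] [Fintype F] {n : ℕ} [NeZero n]
    (hq : Nat.Coprime (Fintype.card F) n) (ψ : AddChar (ZMod n) (AlgebraicClosure F))
    {s : Finset (ZMod n)} (hs : ∀ j ∈ s, (Fintype.card F : ZMod n) * j ∈ s) (t : ZMod n) :
    ∑ j ∈ s, ψ (j * t) ∈ Set.range (algebraMap F (AlgebraicClosure F)) := by
  apply FiniteField.mem_range_algebraMap_of_pow_card_eq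
  -- Frobenius multiplies the exponents by `q`, which only permutes `s`, so it fixes the sum.
  have hfr := map_sum (FiniteField.frobeniusAlgEquivOfAlgebraic F (AlgebraicClosure F))
    (fun j => ψ (j * t)) s
  simp only [FiniteField.coe_frobeniusAlgEquivOfAlgebraic] at hfr
  rw [hfr]
  have hinj : Set.InjOn (fun j => (Fintype.card F : ZMod n) * j) s := by
    intro x _ y _ hxy
    have hxy' : ((ZMod.unitOfCoprime _ hq : (ZMod n)ˣ) : ZMod n) * x =
      (ZMod.unitOfCoprime _ hq : (ZMod n)ˣ) * y := by simpa using hxy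
    exact (Units.mul_right_inj _).1 hxy'
  have himg : s.image (fun j => (Fintype.card F : ZMod n) * j) = s :=
    Finset.eq_of_subset_of_card_le (Finset.image_subset_iff.2 hs)
      (Finset.card_image_of_injOn hinj).ge
  conv_rhs => rw [← himg, Finset.sum_image hinj]
  refine Finset.sum_congr rfl fun j _ => ?_
  rw [← AddChar.map_nsmul_eq_pow, nsmul_eq_mul, mul_assoc]

/-- The dual of an even-like duadic code is a cyclic code with defining set `-S_{i+1}`. -/
theorem IsSplitting.dualCode_evenLikeSubcode_le {F : Type*} [Field F] [Fintype F] {n : ℕ}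
    [NeZero n] (hq : Nat.Coprime (Fintype.card F) n) {S : Fin 2 → Set (ZMod n)} {a : (ZMod n)ˣ}
    (h : IsSplitting (Fintype.card F) n S a) {α : AlgebraicClosure F} (hα : IsPrimitiveRoot α n)
    (i : Fin 2) :
    dualCode (evenLikeSubcode (cyclicCode n α (S i))) ≤
      cyclicCode n α {j | -j ∈ S (i + 1)} := by
  classical
  intro e he
  have hinj := (algebraMap F (AlgebraicClosure F)).injective
  have hn' : (n : AlgebraicClosure F) ≠ 0 := by
    rw [← map_natCast (algebraMap F (AlgebraicClosure F))]
    exact (map_ne_zero_iff _ hinj).2 (natCast_ne_zero_of_coprime_card hq)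
  set ψ := rootChar hα with hψdef
  have hψ : ψ.IsPrimitive := rootChar_isPrimitive hα
  set s : Finset (ZMod n) := {j | j ∈ S (i + 1)} with hsdef
  have hs : ∀ j, j ∈ s ↔ j ∈ S (i + 1) := fun j => by simp [hsdef]
  -- These test words have spectrum supported on `s = S (i + 1)`, hence lie in the even-like code.
  -- Orthogonality of `e` to all of them says that the transform of `j ↦ 1_s(j) ê(-j)` vanishes,
  -- where `ê` is the spectrum of `e`; inversion then kills `ê` on `-s`.
  have hc : ∀ t : ZMod n, ∃ c : Fin n → F, ∀ k,
      algebraMap F (AlgebraicClosure F) (c k) = ∑ j ∈ s, ψ (j * (t - (k : ℕ))) := by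
    intro t
    have := fun k : Fin n => sum_rootChar_mem_range hq ψ (s := s) (fun j hj =>
      (hs _).2 (h.cyclotomic _ _ ((hs _).1 hj))) (t - (k : ℕ))
    choose c hc using this
    exact ⟨c, hc⟩
  have hsum : ∀ l : ZMod n, ∑ k : Fin n, ψ (l * (k : ℕ)) = if l = 0 then (n : AlgebraicClosure F)
      else 0 := by
    intro l
    rw [sum_fin_natCast (fun x => ψ (l * x))]
    simpa [mul_comm, ZMod.card] using AddChar.sum_mulShift l hψ
  have htr : ∀ t l : ZMod n, l ∉ s → ∀ c : Fin n → F, (∀ k,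
      algebraMap F (AlgebraicClosure F) (c k) = ∑ j ∈ s, ψ (j * (t - (k : ℕ)))) →
      wordTransform ψ (fun i => algebraMap F (AlgebraicClosure F) (c i)) l = 0 := by
    intro t l hl c hc
    simp only [wordTransform, hc, Finset.sum_mul]
    rw [Finset.sum_comm]
    refine Finset.sum_eq_zero fun j hj => ?_
    have hne : l - j ≠ 0 := fun h => hl (by rwa [sub_eq_zero.1 h])
    calc ∑ k : Fin n, ψ (j * (t - (k : ℕ))) * ψ (l * (k : ℕ))
        = ψ (j * t) * ∑ k : Fin n, ψ ((l - j) * (k : ℕ)) := by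
          rw [Finset.mul_sum]
          refine Finset.sum_congr rfl fun k _ => ?_
          rw [← AddChar.map_add_eq_mul, ← AddChar.map_add_eq_mul]
          congr 1
          ring
      _ = 0 := by rw [hsum, if_neg hne, mul_zero]
  rw [mem_cyclicCode_iff hα]
  intro j hj
  have key := hψ.injective_transform hn' (g := fun j => if j ∈ s then
    wordTransform ψ (fun i => algebraMap F (AlgebraicClosure F) (e i)) (-j) else 0) (fun t => by
      obtain ⟨c, hct⟩ := hc t
      have hmem : c ∈ evenLikeSubcode (cyclicCode n α (S i)) := by
        refine ⟨(mem_cyclicCode_iff hα).2 fun l hl => htr t l (fun hls =>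
          h.notMem_of_mem ((hs l).1 hls) hl) c hct, hinj ?_⟩
        have := htr t 0 (fun h0 => h.ne_zero_of_mem ((hs 0).1 h0) rfl) c hct
        simpa [wordTransform] using this
      have h1 := congrArg (algebraMap F (AlgebraicClosure F)) (he c hmem)
      simp only [map_sum, map_mul, map_zero, hct] at h1
      refine Eq.trans ?_ h1
      have h2 : ∀ x, (if x ∈ s then wordTransform ψ
          (fun i => algebraMap F (AlgebraicClosure F) (e i)) (-x) else 0) * ψ (x * t) =
          if x ∈ s then wordTransform ψ
          (fun i => algebraMap F (AlgebraicClosure F) (e i)) (-x) * ψ (x * t) else 0 :=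
        fun x => by rw [ite_mul, zero_mul]
      refine (Finset.sum_congr rfl fun x _ => h2 x).trans ?_
      rw [Finset.sum_ite_mem, Finset.univ_inter]
      simp only [wordTransform, Finset.sum_mul]
      rw [Finset.sum_comm]
      refine Finset.sum_congr rfl fun k _ => Finset.sum_congr rfl fun l _ => ?_
      rw [mul_assoc, ← AddChar.map_add_eq_mul, mul_comm]
      congr 2
      ring) (-j)
  have hj' : -j ∈ s := (hs _).2 hj
  simpa only [hj', if_true, neg_neg] using key

theorem one_mem_cyclicCode {F : Type*} [Field F] {n : ℕ} [NeZero n] {α : AlgebraicClosure F}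
    (hα : IsPrimitiveRoot α n) {T : Set (ZMod n)} (hT : (0 : ZMod n) ∉ T) :
    (1 : Fin n → F) ∈ cyclicCode n α T := by
  rw [mem_cyclicCode_iff hα]
  intro j hj
  have hj0 : j ≠ 0 := fun h => hT (h ▸ hj)
  simp only [wordTransform, Pi.one_apply, map_one, one_mul]
  rw [sum_fin_natCast (fun x => rootChar hα (j * x))]
  simpa [mul_comm, hj0] using AddChar.sum_mulShift j (rootChar_isPrimitive hα)

/-! ### The trace character and duality of linear codes -/

/-- The additive character `x ↦ ω ^ tr(x)` of a finite field of characteristic `p`. -/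
noncomputable def traceChar (p : ℕ) [Fact p.Prime] {F : Type*} [Field F] [Algebra (ZMod p) F]
    (x : F) : ℂ :=
  ZMod.stdAddChar (Algebra.trace (ZMod p) F x)

section traceChar

variable (p : ℕ) [Fact p.Prime] {F : Type*} [Field F] [Algebra (ZMod p) F]

theorem traceChar_zero : traceChar p (0 : F) = 1 := by simp [traceChar]

theorem traceChar_add (x y : F) : traceChar p (x + y) = traceChar p x * traceChar p y := by
  simp [traceChar, AddChar.map_add_eq_mul]

theorem exists_traceChar_mul_ne_one [Fintype F] {y : F} (hy : y ≠ 0) :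
    ∃ t : F, traceChar p (t * y) ≠ 1 := by
  have : FiniteDimensional (ZMod p) F := Module.Finite.of_finite
  obtain ⟨x, hx⟩ := Algebra.trace_surjective (ZMod p) F 1
  refine ⟨x / y, fun h => ?_⟩
  rw [div_mul_cancel₀ _ hy, traceChar, hx] at h
  have h1 := ZMod.injective_stdAddChar (h.trans (AddChar.map_zero_eq_one _).symm)
  exact one_ne_zero h1

end traceChar

section linearCode

variable {F : Type*} [Field F] {n : ℕ}

theorem sum_mul_eq_zero_of_mem_dualCode {D : Submodule F (Fin n → F)} {x b : Fin n → F}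
    (hx : x ∈ D) (hb : b ∈ dualCode D) : ∑ i, b i * x i = 0 := by
  rw [← hb x hx]
  exact Finset.sum_congr rfl fun i _ => mul_comm _ _

theorem exists_dualCode_sum_mul_ne_zero {D : Submodule F (Fin n → F)} {x : Fin n → F}
    (hx : x ∉ D) : ∃ b ∈ dualCode D, ∑ i, b i * x i ≠ 0 := by
  obtain ⟨f, hf, hD⟩ := Submodule.exists_le_ker_of_notMem hx
  have hfs : ∀ y : Fin n → F, f y = ∑ i, y i * f (Pi.single i 1) := fun y => by
    rw [LinearMap.pi_apply_eq_sum_univ f y]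
    refine Finset.sum_congr rfl fun i _ => ?_
    rw [smul_eq_mul]
    congr 2
    ext j
    simp [Pi.single_apply, eq_comm]
  refine ⟨fun i => f (Pi.single i 1), fun c hc => ?_, ?_⟩
  · rw [← hfs]
    exact hD hc
  · rw [hfs] at hf
    simpa only [mul_comm] using hf

theorem evenLikeSubcode_le (D : Submodule F (Fin n → F)) : evenLikeSubcode D ≤ D :=
  fun _ h => h.1

theorem sub_const_mem_evenLikeSubcode {D : Submodule F (Fin n → F)} (h1 : (1 : Fin n → F) ∈ D)
    (hn : (n : F) ≠ 0) {x : Fin n → F} (hx : x ∈ D) :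
    x - ((∑ i, x i) / n) • (1 : Fin n → F) ∈ evenLikeSubcode D := by
  refine ⟨D.sub_mem hx (D.smul_mem _ h1), ?_⟩
  simp [Finset.sum_sub_distrib, mul_div_cancel₀ _ hn]

/-- A word orthogonal to the even-like subcode of `D` that is itself even-like is orthogonal to
`D`. -/
theorem mem_dualCode_of_sum_eq_zero {D : Submodule F (Fin n → F)} (h1 : (1 : Fin n → F) ∈ D)
    (hn : (n : F) ≠ 0) {b : Fin n → F} (hb : b ∈ dualCode (evenLikeSubcode D))
    (h0 : ∑ i, b i = 0) : b ∈ dualCode D := by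
  intro x hx
  have h := hb _ (sub_const_mem_evenLikeSubcode h1 hn hx)
  simpa [sub_mul, Finset.sum_sub_distrib, ← Finset.mul_sum, h0] using h

theorem hammingNorm_le_errorWeight [DecidableEq F] (a b : Fin n → F) :
    hammingNorm a ≤ errorWeight a b ∧ hammingNorm b ≤ errorWeight a b := by
  simp only [errorWeight, hammingNorm]
  constructor <;> refine Finset.card_le_card (Finset.monotone_filter_right _ fun i _ hi h => ?_)
  · exact hi (congrArg Prod.fst h)
  · exact hi (congrArg Prod.snd h)

theorem errorWeight_zero_right [DecidableEq F] (a : Fin n → F) :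
    errorWeight a 0 = hammingNorm a := by
  simp [errorWeight, hammingNorm, Prod.ext_iff]

theorem errorWeight_zero_left [DecidableEq F] (b : Fin n → F) :
    errorWeight 0 b = hammingNorm b := by
  simp [errorWeight, hammingNorm, Prod.ext_iff]

end linearCode

/-- Detection for unnormalised vectors, with the norms cleared, so that explicit code vectors can be
tested directly. -/
theorem Detects.inner_mul_eq {F : Type*} [Fintype F] {n : ℕ} {Q : Submodule ℂ (QSpace F n)}
    {E : QSpace F n →ₗ[ℂ] QSpace F n}
    (h : Detects Q E) {u v : QSpace F n} (hu : u ∈ Q) (hv : v ∈ Q) (hu0 : u ≠ 0) (hv0 : v ≠ 0) :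
    inner ℂ u (E u) * inner ℂ v v = inner ℂ v (E v) * inner ℂ u u := by
  have hun : (‖u‖ : ℂ) ≠ 0 := by simpa using hu0
  have hvn : (‖v‖ : ℂ) ≠ 0 := by simpa using hv0
  have key := h ((‖u‖⁻¹ : ℂ) • u) (Q.smul_mem _ hu) ((‖v‖⁻¹ : ℂ) • v) (Q.smul_mem _ hv)
    (by simp [norm_smul, hu0]) (by simp [norm_smul, hv0])
  simp only [map_smul, inner_smul_left, inner_smul_right, map_inv₀, Complex.conj_ofReal] at key
  rw [inner_self_eq_norm_sq_to_K, inner_self_eq_norm_sq_to_K]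
  simp only [Complex.coe_algebraMap]
  field_simp at key
  linear_combination key

/-! ### The CSS code: structure, dimension and detectable errors -/

section cssCode

variable {p : ℕ} [Fact p.Prime] {F : Type*} [Field F] [Fintype F] [Algebra (ZMod p) F] {n : ℕ}

theorem shiftOp_phaseOp_apply (a b : Fin n → F) (v : QSpace F n) (y : Fin n → F) :
    (shiftOp a ∘ₗ phaseOp p b) v y = traceChar p (∑ i, b i * (y - a) i) * v (y - a) := rfl

theorem errorOp_apply (c : ZMod p) (a b : Fin n → F) (v : QSpace F n) (y : Fin n → F) :
    errorOp c a b v y =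
      ZMod.stdAddChar c * (traceChar p (∑ i, b i * (y - a) i) * v (y - a)) := rfl

theorem errorOp_zero (a b : Fin n → F) :
    errorOp (p := p) 0 a b = shiftOp a ∘ₗ phaseOp p b := by
  simp [errorOp]

theorem shiftOp_phaseOp_zero : shiftOp (0 : Fin n → F) ∘ₗ phaseOp p 0 = LinearMap.id := by
  refine LinearMap.ext fun v => ?_
  ext y
  rw [shiftOp_phaseOp_apply]
  simp [traceChar_zero]

/-- Composition of the Weyl operators `X(a) Z(b)` whose phase and shift parts are orthogonal. -/
theorem shiftOp_phaseOp_comp {a a' b b' : Fin n → F} (h : ∑ i, b i * a' i = 0) :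
    (shiftOp a ∘ₗ phaseOp p b) ∘ₗ (shiftOp a' ∘ₗ phaseOp p b') =
      shiftOp (a + a') ∘ₗ phaseOp p (b + b') := by
  refine LinearMap.ext fun v => ?_
  ext y
  rw [LinearMap.comp_apply, shiftOp_phaseOp_apply, shiftOp_phaseOp_apply, shiftOp_phaseOp_apply,
    ← mul_assoc, ← traceChar_add, sub_sub]
  congr 2
  have h1 : ∀ i, (b + b') i * (y - (a + a')) i =
      b i * (y - a) i + b' i * (y - (a + a')) i - b i * a' i := by
    intro i
    simp only [Pi.add_apply, Pi.sub_apply]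
    ring
  simp only [h1, Finset.sum_sub_distrib, Finset.sum_add_distrib, h, sub_zero]

/-- The CSS code consists of the vectors supported on `D` and constant on the cosets of `C`. -/
theorem mem_cssCode_iff {C D : Submodule F (Fin n → F)} (hCD : C ≤ D) {v : QSpace F n} :
    v ∈ cssCode p C D ↔ (∀ x ∉ D, v x = 0) ∧ ∀ a ∈ C, ∀ x, v (x - a) = v x := by
  constructor
  · intro hv
    refine ⟨fun x hx => ?_, fun a ha x => ?_⟩
    · obtain ⟨b, hb, hbx⟩ := exists_dualCode_sum_mul_ne_zero hx
      obtain ⟨t, ht⟩ := exists_traceChar_mul_ne_one p hbx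
      have h := congrArg (fun w : QSpace F n => w x)
        (hv 0 C.zero_mem (t • b) ((dualCode D).smul_mem t hb))
      simp only [shiftOp_phaseOp_apply, sub_zero, Pi.smul_apply, smul_eq_mul, mul_assoc,
        ← Finset.mul_sum] at h
      by_contra h0
      exact ht ((mul_eq_right₀ h0).1 h)
    · have h := congrArg (fun w : QSpace F n => w x) (hv a ha 0 (dualCode D).zero_mem)
      simp only [shiftOp_phaseOp_apply] at h
      simpa [traceChar_zero] using h
  · rintro ⟨h1, h2⟩ a ha b hb
    ext y
    rw [shiftOp_phaseOp_apply, h2 a ha]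
    by_cases hy : y ∈ D
    · rw [sum_mul_eq_zero_of_mem_dualCode (D.sub_mem hy (hCD ha)) hb, traceChar_zero, one_mul]
    · rw [h1 y hy, mul_zero]

theorem isStabilizerCode_cssCode {C D : Submodule F (Fin n → F)} (hCD : C ≤ D)
    (h : cssCode p C D ≠ ⊥) : IsStabilizerCode p (cssCode p C D) := by
  have hcomp : ∀ {a a' b b' : Fin n → F}, a' ∈ C → b ∈ dualCode D →
      (shiftOp a ∘ₗ phaseOp p b) * (shiftOp a' ∘ₗ phaseOp p b') =
        shiftOp (a + a') ∘ₗ phaseOp p (b + b') := fun ha hb =>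
    shiftOp_phaseOp_comp (sum_mul_eq_zero_of_mem_dualCode (hCD ha) hb)
  have hinv : ∀ {a b : Fin n → F}, a ∈ C → b ∈ dualCode D →
      (shiftOp a ∘ₗ phaseOp p b) * (shiftOp (-a) ∘ₗ phaseOp p (-b)) = 1 := fun ha hb => by
    rw [hcomp (C.neg_mem ha) hb, add_neg_cancel, add_neg_cancel, shiftOp_phaseOp_zero]
    rfl
  have hinv' : ∀ {a b : Fin n → F}, a ∈ C → b ∈ dualCode D →
      (shiftOp (-a) ∘ₗ phaseOp p (-b)) * (shiftOp a ∘ₗ phaseOp p b) = 1 := fun ha hb => by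
    rw [hcomp ha ((dualCode D).neg_mem hb), neg_add_cancel, neg_add_cancel, shiftOp_phaseOp_zero]
    rfl
  refine ⟨h, ⟨⟨⟨{g | ∃ a ∈ C, ∃ b ∈ dualCode D,
    (g : QSpace F n →ₗ[ℂ] QSpace F n) = shiftOp a ∘ₗ phaseOp p b}, ?_⟩, ?_⟩, ?_⟩, ?_, ?_⟩
  · rintro g g' ⟨a, ha, b, hb, hg⟩ ⟨a', ha', b', hb', hg'⟩
    refine ⟨a + a', C.add_mem ha ha', b + b', (dualCode D).add_mem hb hb', ?_⟩
    rw [Units.val_mul, hg, hg', hcomp ha' hb]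
  · exact ⟨0, C.zero_mem, 0, (dualCode D).zero_mem, by rw [shiftOp_phaseOp_zero]; rfl⟩
  · rintro g ⟨a, ha, b, hb, hg⟩
    refine ⟨-a, C.neg_mem ha, -b, (dualCode D).neg_mem hb, ?_⟩
    exact Units.inv_eq_of_mul_eq_one_right (by rw [hg, hinv ha hb])
  · rintro g ⟨a, -, b, -, hg⟩
    exact ⟨0, a, b, by rw [hg, errorOp_zero]⟩
  · intro v
    constructor
    · rintro hv g ⟨a, ha, b, hb, hg⟩
      rw [hg]
      exact hv a ha b hb
    · intro hv a ha b hb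
      exact hv ⟨_, _, hinv ha hb, hinv' ha hb⟩ ⟨a, ha, b, hb, rfl⟩

open Classical in
/-- The vector with amplitude `f (∑ xᵢ)` at the words `x` of `D`. -/
noncomputable def sumVec (D : Submodule F (Fin n → F)) : (F → ℂ) →ₗ[ℂ] QSpace F n where
  toFun f := WithLp.toLp 2 fun x => if x ∈ D then f (∑ i, x i) else 0
  map_add' f g := by
    ext x
    by_cases hx : x ∈ D <;> simp [hx]
  map_smul' r f := by
    ext x
    by_cases hx : x ∈ D <;> simp [hx]

theorem sumVec_of_mem {D : Submodule F (Fin n → F)} (f : F → ℂ) {x : Fin n → F} (hx : x ∈ D) :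
    sumVec D f x = f (∑ i, x i) := by simp [sumVec, hx]

theorem sumVec_of_notMem {D : Submodule F (Fin n → F)} (f : F → ℂ) {x : Fin n → F} (hx : x ∉ D) :
    sumVec D f x = 0 := by simp [sumVec, hx]

theorem sumVec_mem (D : Submodule F (Fin n → F)) (f : F → ℂ) :
    sumVec D f ∈ cssCode p (evenLikeSubcode D) D := by
  rw [mem_cssCode_iff (evenLikeSubcode_le D)]
  refine ⟨fun x hx => sumVec_of_notMem f hx, fun a ha x => ?_⟩
  by_cases hx : x ∈ D
  · rw [sumVec_of_mem f hx, sumVec_of_mem f (D.sub_mem hx ha.1)]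
    simp [Finset.sum_sub_distrib, ha.2]
  · rw [sumVec_of_notMem f hx, sumVec_of_notMem f fun h => hx (by simpa using D.add_mem h ha.1)]

/-- The constant word `t/n` has coordinate sum `t`, so it represents the coset of `C` in `D`
labelled by `t`. -/
theorem sumVec_const {D : Submodule F (Fin n → F)} (h1 : (1 : Fin n → F) ∈ D) (hn : (n : F) ≠ 0)
    (f : F → ℂ) (t : F) : sumVec D f ((t / n) • (1 : Fin n → F)) = f t := by
  rw [sumVec_of_mem f (D.smul_mem _ h1)]
  simp [mul_div_cancel₀ _ hn]

theorem finrank_cssCode {D : Submodule F (Fin n → F)} (h1 : (1 : Fin n → F) ∈ D)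
    (hn : (n : F) ≠ 0) :
    Module.finrank ℂ (cssCode p (evenLikeSubcode D) D) = Fintype.card F := by
  have hinj : Function.Injective (sumVec D) := fun f g h => by
    ext t
    rw [← sumVec_const h1 hn f t, h, sumVec_const h1 hn]
  have hrange : LinearMap.range (sumVec D) = cssCode p (evenLikeSubcode D) D := by
    apply le_antisymm
    · rintro _ ⟨f, rfl⟩
      exact sumVec_mem D f
    · intro v hv
      rw [mem_cssCode_iff (evenLikeSubcode_le D)] at hv
      refine ⟨fun t => v ((t / n) • (1 : Fin n → F)), ?_⟩
      ext x
      by_cases hx : x ∈ D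
      · rw [sumVec_of_mem _ hx, ← hv.2 _ (sub_const_mem_evenLikeSubcode h1 hn hx) x,
          sub_sub_cancel]
      · rw [sumVec_of_notMem _ hx, hv.1 x hx]
  rw [← hrange, LinearMap.finrank_range_of_inj hinj, Module.finrank_pi]

/-- The shift moves the support from `D` to the disjoint coset `a + D`. -/
theorem inner_errorOp_eq_zero_of_notMem {C D : Submodule F (Fin n → F)} (hCD : C ≤ D)
    {u : QSpace F n} (hu : u ∈ cssCode p C D) (c : ZMod p) {a : Fin n → F} (b : Fin n → F)
    (ha : a ∉ D) : inner ℂ u (errorOp c a b u) = 0 := by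
  rw [mem_cssCode_iff hCD] at hu
  rw [PiLp.inner_apply]
  refine Finset.sum_eq_zero fun y _ => ?_
  rw [errorOp_apply]
  by_cases hy : y ∈ D
  · rw [hu.1 (y - a) fun h => ha (by simpa using D.sub_mem hy h)]
    simp
  · rw [hu.1 y hy]
    simp

/-- Translating the summation variable by a multiple of some `x ∈ C` not orthogonal to `b` leaves
`u` unchanged but multiplies the expectation by a phase different from `1`. -/
theorem inner_errorOp_eq_zero_of_notMem_dualCode {C D : Submodule F (Fin n → F)} (hCD : C ≤ D)
    {u : QSpace F n} (hu : u ∈ cssCode p C D) (c : ZMod p) (a : Fin n → F) {b : Fin n → F}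
    (hb : b ∉ dualCode C) : inner ℂ u (errorOp c a b u) = 0 := by
  rw [mem_cssCode_iff hCD] at hu
  obtain ⟨x, hx, hbx⟩ : ∃ x ∈ C, ∑ i, x i * b i ≠ 0 := by
    by_contra! h
    exact hb h
  obtain ⟨t, ht⟩ := exists_traceChar_mul_ne_one p hbx
  have htx : -(t • x) ∈ C := C.neg_mem (C.smul_mem t hx)
  have hsum : inner ℂ u (errorOp c a b u) =
      traceChar p (t * ∑ i, x i * b i) * inner ℂ u (errorOp c a b u) := by
    conv_lhs => rw [PiLp.inner_apply, ← Equiv.sum_comp (Equiv.addRight (t • x))]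
    rw [PiLp.inner_apply, Finset.mul_sum]
    refine Finset.sum_congr rfl fun y _ => ?_
    have h1 : u (y + t • x) = u y := by simpa using hu.2 _ htx y
    have h2 : u (y + t • x - a) = u (y - a) := by
      have := hu.2 _ htx (y - a)
      rwa [sub_neg_eq_add, sub_add_eq_add_sub] at this
    have h3 : ∑ i, b i * (y + t • x - a) i = t * ∑ i, x i * b i + ∑ i, b i * (y - a) i := by
      rw [Finset.mul_sum, ← Finset.sum_add_distrib]
      refine Finset.sum_congr rfl fun i _ => ?_
      simp only [Pi.add_apply, Pi.sub_apply, Pi.smul_apply, smul_eq_mul]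
      ring
    rw [Equiv.coe_addRight, errorOp_apply, errorOp_apply, h1, h2, h3, traceChar_add]
    simp only [RCLike.inner_apply]
    ring
  by_contra h0
  exact ht ((mul_eq_right₀ h0).1 hsum.symm)

theorem detects_errorOp_of_mem {C D : Submodule F (Fin n → F)} (c : ZMod p) {a b : Fin n → F}
    (ha : a ∈ C) (hb : b ∈ dualCode D) : Detects (cssCode p C D) (errorOp c a b) := by
  have h : ∀ u ∈ cssCode p C D, ‖u‖ = 1 → inner ℂ u (errorOp c a b u) = ZMod.stdAddChar c := by
    intro u hu hu1
    rw [errorOp, LinearMap.smul_apply, hu a ha b hb, inner_smul_right,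
      inner_self_eq_norm_sq_to_K, hu1]
    simp
  intro u hu v hv hu1 hv1
  rw [h u hu hu1, h v hv hv1]

-- The shift by `e` fixes the uniform vector on `D`, but sends the state supported on sum-zero words
-- to an orthogonal one.
open Classical in
theorem not_detects_shift {D : Submodule F (Fin n → F)} (h1 : (1 : Fin n → F) ∈ D)
    (hn : (n : F) ≠ 0) {e : Fin n → F} (he : e ∈ D) (h0 : ∑ i, e i ≠ 0) :
    ¬ Detects (cssCode p (evenLikeSubcode D) D) (errorOp (0 : ZMod p) e 0) := by
  intro hdet
  set u := sumVec D (Pi.single 0 1) with hu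
  set v := sumVec D (fun _ => 1) with hv
  have hu0 : u ≠ 0 := fun h => by
    have := sumVec_const h1 hn (Pi.single 0 1) 0
    rw [← hu, h] at this
    simp at this
  have hv0 : v ≠ 0 := fun h => by
    have := sumVec_const h1 hn (fun _ => 1) 0
    rw [← hv, h] at this
    simp at this
  have hE : ∀ w y, errorOp (0 : ZMod p) e 0 w y = w (y - e) := by
    intro w y
    simp [errorOp_apply, traceChar_zero]
  have hEv : errorOp (0 : ZMod p) e 0 v = v := by
    ext y
    rw [hE]
    by_cases hy : y ∈ D
    · rw [hv, sumVec_of_mem _ hy, sumVec_of_mem _ (D.sub_mem hy he)]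
    · rw [hv, sumVec_of_notMem _ hy, sumVec_of_notMem _ fun h => hy (by simpa using D.add_mem h he)]
  have hEu : inner ℂ u (errorOp (0 : ZMod p) e 0 u) = 0 := by
    rw [PiLp.inner_apply]
    refine Finset.sum_eq_zero fun y _ => ?_
    rw [hE]
    by_cases hy : y ∈ D
    · rw [hu, sumVec_of_mem _ hy, sumVec_of_mem _ (D.sub_mem hy he)]
      by_cases hs : ∑ i, y i = 0
      · have : ∑ i, (y - e) i ≠ 0 := by simpa [Finset.sum_sub_distrib, hs] using h0
        rw [Pi.single_eq_of_ne this, inner_zero_right]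
      · rw [Pi.single_eq_of_ne hs, inner_zero_left]
    · rw [hu, sumVec_of_notMem _ hy, inner_zero_left]
  have key := hdet.inner_mul_eq (sumVec_mem D _) (sumVec_mem D _) hu0 hv0
  rw [hEu, hEv, zero_mul] at key
  exact mul_ne_zero (inner_self_ne_zero.2 hv0) (inner_self_ne_zero.2 hu0) key.symm

-- For `x ∈ D`, `e · x` depends only on the coordinate sum of `x`. So each basis state labelled by
-- `t` is an eigenvector with eigenvalue `traceChar p (t / n * ∑ e)`, which varies with `t`.
open Classical in
theorem not_detects_phase {D : Submodule F (Fin n → F)} (h1 : (1 : Fin n → F) ∈ D)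
    (hn : (n : F) ≠ 0) {e : Fin n → F} (he : e ∈ dualCode (evenLikeSubcode D))
    (h0 : ∑ i, e i ≠ 0) :
    ¬ Detects (cssCode p (evenLikeSubcode D) D) (errorOp (0 : ZMod p) 0 e) := by
  intro hdet
  have hu0 : ∀ t, sumVec D (Pi.single t 1) ≠ 0 := fun t h => by
    have := sumVec_const h1 hn (Pi.single t 1) t
    rw [h] at this
    simp at this
  have hE : ∀ t, errorOp (0 : ZMod p) 0 e (sumVec D (Pi.single t 1)) =
      traceChar p (t / n * ∑ i, e i) • sumVec D (Pi.single t 1) := by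
    intro t
    ext y
    rw [errorOp_apply, PiLp.smul_apply, smul_eq_mul, sub_zero, AddChar.map_zero_eq_one, one_mul]
    by_cases hy : y ∈ D
    · by_cases hs : ∑ i, y i = t
      · have h := he _ (sub_const_mem_evenLikeSubcode h1 hn hy)
        have h2 : ∑ i, e i * y i = t / n * ∑ i, e i := by
          simp only [Pi.sub_apply, Pi.smul_apply, Pi.one_apply, smul_eq_mul, mul_one, sub_mul,
            Finset.sum_sub_distrib, ← Finset.mul_sum, hs, sub_eq_zero] at h
          rw [← h]
          exact Finset.sum_congr rfl fun i _ => mul_comm _ _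
        rw [h2]
      · rw [sumVec_of_mem _ hy, Pi.single_eq_of_ne hs, mul_zero, mul_zero]
    · rw [sumVec_of_notMem _ hy, mul_zero, mul_zero]
  obtain ⟨t, ht⟩ := exists_traceChar_mul_ne_one p h0
  -- The label `t * n` cancels the `n` in the eigenvalue; the label `0` has eigenvalue `1`.
  have key := hdet.inner_mul_eq (sumVec_mem D (Pi.single (t * n) 1))
    (sumVec_mem D (Pi.single 0 1)) (hu0 _) (hu0 _)
  rw [hE, hE, inner_smul_right, inner_smul_right, zero_div, zero_mul, traceChar_zero, one_mul,
    mul_div_cancel_right₀ _ hn, mul_assoc, mul_comm (inner ℂ _ _)] at key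
  exact ht ((mul_eq_right₀ (mul_ne_zero (inner_self_ne_zero.2 (hu0 _))
    (inner_self_ne_zero.2 (hu0 _)))).1 key)

/-- The CSS code of the even-like subcode of a code `D` containing the all-ones word encodes one
qudit, and its distance is the weight of an odd-like word of `D` or of the dual of the subcode. -/
theorem exists_isQuantumCode_cssCode [DecidableEq F] {D : Submodule F (Fin n → F)}
    (h1 : (1 : Fin n → F) ∈ D) (hn : (n : F) ≠ 0) :
    ∃ e : Fin n → F, ∑ i, e i ≠ 0 ∧ (e ∈ D ∨ e ∈ dualCode (evenLikeSubcode D)) ∧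
      IsQuantumCode p (cssCode p (evenLikeSubcode D) D) 1 (hammingNorm e) := by
  classical
  -- The distance is the least weight of an odd-like word in `D ∪ C^⊥`; the all-ones word shows that
  -- one exists.
  have hex : ∃ d, ∃ e : Fin n → F, (∑ i, e i ≠ 0 ∧ (e ∈ D ∨ e ∈ dualCode (evenLikeSubcode D))) ∧
      hammingNorm e = d := ⟨_, 1, ⟨by simpa using hn, Or.inl h1⟩, rfl⟩
  obtain ⟨e, ⟨he0, he⟩, hed⟩ := Nat.find_spec hex
  have hmin : ∀ x : Fin n → F, hammingNorm x < hammingNorm e →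
      (x ∈ D ∨ x ∈ dualCode (evenLikeSubcode D)) → ∑ i, x i = 0 := by
    intro x hx hxm
    by_contra h0
    exact Nat.find_min hex (hed ▸ hx) ⟨x, ⟨h0, hxm⟩, rfl⟩
  have hrank := finrank_cssCode (p := p) h1 hn
  refine ⟨e, he0, he, ?_, ?_, ?_, ?_⟩
  · refine isStabilizerCode_cssCode (evenLikeSubcode_le D) fun h => ?_
    rw [h, finrank_bot] at hrank
    exact Fintype.card_ne_zero hrank.symm
  · rw [hrank, pow_one]
  · intro c a b hw
    by_cases ha : a ∈ D
    · by_cases hb : b ∈ dualCode (evenLikeSubcode D)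
      · have ha0 := hmin a ((hammingNorm_le_errorWeight a b).1.trans_lt hw) (Or.inl ha)
        have hb0 := hmin b ((hammingNorm_le_errorWeight a b).2.trans_lt hw) (Or.inr hb)
        exact detects_errorOp_of_mem c ⟨ha, ha0⟩ (mem_dualCode_of_sum_eq_zero h1 hn hb hb0)
      · intro u hu v hv _ _
        rw [inner_errorOp_eq_zero_of_notMem_dualCode (evenLikeSubcode_le D) hu c a hb,
          inner_errorOp_eq_zero_of_notMem_dualCode (evenLikeSubcode_le D) hv c a hb]
    · intro u hu v hv _ _
      rw [inner_errorOp_eq_zero_of_notMem (evenLikeSubcode_le D) hu c b ha,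
        inner_errorOp_eq_zero_of_notMem (evenLikeSubcode_le D) hv c b ha]
  · rcases he with he | he
    · exact ⟨0, e, 0, errorWeight_zero_right e, not_detects_shift h1 hn he he0⟩
    · exact ⟨0, 0, e, errorWeight_zero_left e, not_detects_phase h1 hn he he0⟩

end cssCode

/-! ### Distance bounds for quantum duadic codes and the main theorem -/

theorem IsDuadicPair.exists_isQuantumCode {p : ℕ} [Fact p.Prime] {F : Type*} [Field F]
    [Fintype F] [DecidableEq F] [Algebra (ZMod p) F] {n : ℕ} [NeZero n]
    (hcop : Nat.Coprime (Fintype.card F) n) {a : (ZMod n)ˣ} {C D : Submodule F (Fin n → F)}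
    (h : IsDuadicPair n a C D) :
    ∃ d : ℕ, IsQuantumCode p (cssCode p C D) 1 d ∧ n ≤ d ^ 2 ∧
      (a = -1 → (n : ℤ) ≤ (d : ℤ) ^ 2 - d + 1) := by
  obtain ⟨S, α, i, hS, hα, rfl, rfl⟩ := h
  have hn := natCast_ne_zero_of_coprime_card hcop
  obtain ⟨e, he0, he, hQ⟩ := exists_isQuantumCode_cssCode (p := p)
    (one_mem_cyclicCode hα fun h => hS.ne_zero_of_mem h rfl) hn
  refine ⟨_, hQ, ?_⟩
  rcases he with he | he
  · exact le_hammingNorm_sq hn hα he he0 fun j hj => hS.mem_or_mul_mem i hj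
  · refine le_hammingNorm_sq hn hα (hS.dualCode_evenLikeSubcode_le hcop hα i he) he0
      fun j hj => ?_
    -- The defining set is now `-S (i + 1)`, so the covering property is applied to `-j`.
    have := hS.mem_or_mul_mem (i + 1) (neg_ne_zero.2 hj)
    rwa [mul_neg] at this

theorem IsSplitting.exists_isQuantumDuadicCode {p : ℕ} [Fact p.Prime] {F : Type*} [Field F]
    [Fintype F] [Algebra (ZMod p) F] {n : ℕ} (hcop : Nat.Coprime (Fintype.card F) n)
    {S : Fin 2 → Set (ZMod n)} {a : (ZMod n)ˣ} (h : IsSplitting (Fintype.card F) n S a) :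
    ∃ Q : Submodule ℂ (QSpace F n), IsQuantumDuadicCode p a Q := by
  -- Invertibility of `n` in `F` is what yields a primitive `n`-th root of unity in the algebraic
  -- closure.
  have : NeZero (n : F) := ⟨natCast_ne_zero_of_coprime_card hcop⟩
  obtain ⟨α, hα⟩ := HasEnoughRootsOfUnity.exists_primitiveRoot (AlgebraicClosure F) n
  exact ⟨_, _, _, ⟨S, α, 0, h, hα, rfl, rfl⟩, rfl⟩

theorem theorem3 {p : ℕ} [Fact p.Prime] {F : Type*} [Field F] [Fintype F] [DecidableEq F]
    [Algebra (ZMod p) F] (n : ℕ) (hn : Odd n) (hcop : Nat.Coprime (Fintype.card F) n)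
    (hsq : IsSquare ((Fintype.card F : ℕ) : ZMod n)) :
    (∃ (a : (ZMod n)ˣ) (Q : Submodule ℂ (QSpace F n)), IsQuantumDuadicCode p a Q) ∧
    (∀ (a : (ZMod n)ˣ) (Q : Submodule ℂ (QSpace F n)), IsQuantumDuadicCode p a Q →
      ∃ d : ℕ, IsQuantumCode p Q 1 d ∧ n ≤ d ^ 2) ∧
    (Odd (orderOf ((Fintype.card F : ℕ) : ZMod n)) →
      (∃ Q : Submodule ℂ (QSpace F n), IsQuantumDuadicCode p (-1) Q) ∧
      ∀ Q : Submodule ℂ (QSpace F n), IsQuantumDuadicCode p (-1) Q →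
        ∃ d : ℕ, IsQuantumCode p Q 1 d ∧ (n : ℤ) ≤ (d : ℤ) ^ 2 - d + 1) := by
  have : NeZero n := ⟨hn.pos.ne'⟩
  refine ⟨?_, ?_, fun hord => ⟨?_, ?_⟩⟩
  · obtain ⟨a, S, hS⟩ := exists_isSplitting hn hcop hsq
    exact ⟨a, hS.exists_isQuantumDuadicCode hcop⟩
  · rintro a _ ⟨C, D, h, rfl⟩
    obtain ⟨d, hQ, hd, -⟩ := h.exists_isQuantumCode (p := p) hcop
    exact ⟨d, hQ, hd⟩
  · obtain ⟨S, hS⟩ := exists_isSplitting_neg_one hn hcop hord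
    exact hS.exists_isQuantumDuadicCode hcop
  · rintro _ ⟨C, D, h, rfl⟩
    obtain ⟨d, hQ, -, hd⟩ := h.exists_isQuantumCode (p := p) hcop
    exact ⟨d, hQ, hd rfl⟩
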